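/- **Theorem (Consistency of a bootstrap tree under minimal node size).** *Data.* Let $(X_1,Y_1),(X_2,Y_2),\dots$ be iid, $X_i\in[0,1]^d$, $Y_i\in\mathbb R$, and write $(X,Y)$ for a generic observation. Assume that $X$ has a continuous density $f$ on $[0,1]^d$ with $0<\varepsilon\le f\le C<\infty$, that $\mathbb E[Y^2]<\infty$, and that $x\mapsto\mathbb E[Y^2\mid X=x]$ is continuous on $[0,1]^d$ and bounded by a constant $K$. *Honest bootstrap tree.* For each $n$ the first $n$ observations are partitioned deterministically into a prediction part $\mathcal I$ and a growing part $\mathcal J$, with $n_{\mathcal I}=|\mathcal I|=\Theta(n)$ and $n_{\mathcal J}=|\mathcal J|=\Theta(n)$. Let $W_1^{\mathcal I},\dots,W_{n_{\mathcal I}}^{\mathcal I}$ and $W_1^{\mathcal J},\dots,W_{n_{\mathcal J}}^{\mathcal J}$ be bootstrap weights for the two parts and $\theta$ an auxiliary random parameter; $\theta$, the observations, the $\mathcal I$-weights and the $\mathcal J$-weights are mutually independent. A finite binary tree is grown from $\theta$, $\mathcal J$ and the $\mathcal J$-weights only: starting from the unit cube, each split divides a node by $z_j\le c$ versus $z_j>c$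 for some feature $j$ and some threshold $c$ in the $j$-th interval of the node. Let $L^*(x,\theta)=\prod_{j=1}^d(a_j^{*},b_j^{*}]$ be the leaf into which $x\in[0,1]^d$ is routed, and put (with $\mathcal I$ indexed by $1,\dots,n_{\mathcal I}$) $$N_L^*(x,\theta)=\sum_{i=1}^{n_{\mathcal I}}W_i^{\mathcal I}\mathbf 1_{\{X_i\in L^*(x,\theta)\}},\qquad N_L^{j,*}(x,\theta)=\sum_{i=1}^{n_{\mathcal I}}W_i^{\mathcal I}\mathbf 1_{\{X_i^j\in(a_j^*,b_j^*]\}},\qquad T^*(x,\theta)=\sum_{i=1}^{n_{\mathcal I}}\frac{W_i^{\mathcal I}\mathbf 1_{\{X_i\in L^*(x,\theta)\}}}{N_L^*(x,\theta)}\,Y_i .$$ *Weights.* Assume that the $\mathcal I$-weights are non-negative, exchangeable for each $n$, integrable, and square-integrable for large $n$, that $\sup_n\mathbb E[W_1^{\mathcal I}]<\infty$, that $\mathbb E[W_1^{\mathcal I}W_2^{\mathcal I}]/\mathbb E[W_1^{\mathcal I}]^2\to1$, that $\mathbb E[(W_1^{\mathcal I})^2]/\mathbb E[W_1^{\mathcal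 I}]$ has a finite limit, that $n_{\mathcal I}\mathbb E[W_1^{\mathcal I}]\to\infty$, and that, with $\widetilde W_i^{\mathcal I}=W_i^{\mathcal I}/\mathbb E[W_1^{\mathcal I}]$, there is a constant $C'$ such that $$\mathbb E[(\widetilde W_1^{\mathcal I}-1)(\widetilde W_2^{\mathcal I}-1)]\le C'/n_{\mathcal I}\quad\text{for all large } n$$ (in particular, this holds if the left-hand side is $O(1/n_{\mathcal I})$). *Conclusion.* Let $x\in[0,1]^d$, and let $\mu$ be a version of the regression function $z\mapsto\mathbb E[Y\mid X=z]$ that is continuous at $x$ (relative to $[0,1]^d$). Suppose that $$\frac{N_L^{j,*}(x,\theta)}{n_{\mathcal I}\mathbb E[W_1^{\mathcal I}]}\overset{\mathbb P}{\to}0\quad\text{for all }j=1,\dots,d,$$ and that, for some $\beta\in(1/2,1)$ and $k_n=\lceil(n_{\mathcal I}\mathbb E[W_1^{\mathcal I}])^\beta\rceil$, $$\mathbb P\big(N_L^*(x,\theta)\ge k_n\big)\to1 .$$ Then the tree is weakly consistent at $x$: $T^*(x,\theta)\overset{\mathbb P}{\to}\mu(x)=\mathbb E[Y\mid X=x]$.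 -/

import Mathlib

open MeasureTheory ProbabilityTheory Filter Topology Asymptotics

namespace BootstrapTree

/-- The unit cube `[0,1]^d`. -/
def unitCube (d : ℕ) : Set (Fin d → ℝ) := Set.Icc 0 1

/-! ### Decision trees with binary splits on single features -/

/-- A node of a tree, i.e. the box `∏ⱼ (lowerⱼ, upperⱼ]`. -/
structure Cell (d : ℕ) where
  lower : Fin d → ℝ
  upper : Fin d → ℝ

namespace Cell

variable {d : ℕ}

/-- The root node, with all intervals equal to `(0, 1]`. -/
def root (d : ℕ) : Cell d := ⟨0, 1⟩

/-- The left child: points whose `j`-th coordinate is at most `c`. -/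
def left (A : Cell d) (j : Fin d) (c : ℝ) : Cell d :=
  ⟨A.lower, Function.update A.upper j c⟩

/-- The right child: points whose `j`-th coordinate exceeds `c`. -/
def right (A : Cell d) (j : Fin d) (c : ℝ) : Cell d :=
  ⟨Function.update A.lower j c, A.upper⟩

/-- The `j`-th interval `(lowerⱼ, upperⱼ]` of a node. -/
def side (A : Cell d) (j : Fin d) : Set ℝ := Set.Ioc (A.lower j) (A.upper j)

/-- The node as a subset of `ℝ^d`. -/
def toSet (A : Cell d) : Set (Fin d → ℝ) := {z | ∀ j, z j ∈ A.side j}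

end Cell

/-- A finite binary tree; an inner node carries the feature `j` on which it splits and the
threshold `c`. -/
inductive SplitTree (d : ℕ) where
  | leaf : SplitTree d
  | node (j : Fin d) (c : ℝ) (l r : SplitTree d) : SplitTree d

namespace SplitTree

variable {d : ℕ}

/-- If the tree is rooted at the cell `A`, then each threshold lies in the interval of its node. -/
def SplitsWithin : SplitTree d → Cell d → Prop
  | leaf, _ => True
  | node j c l r, A =>
      c ∈ Set.Icc (A.lower j) (A.upper j) ∧
        l.SplitsWithin (A.left j c) ∧ r.SplitsWithin (A.right j c)

open Classical in
/-- The leaf into which `x` falls, if the tree is rooted at the cell `A`. -/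
noncomputable def leafFrom (x : Fin d → ℝ) : SplitTree d → Cell d → Cell d
  | leaf, A => A
  | node j c l r, A =>
      if x j ≤ c then l.leafFrom x (A.left j c) else r.leafFrom x (A.right j c)

/-- The leaf into which `x` falls, if the tree is rooted at the unit cube. -/
noncomputable def leafAt (T : SplitTree d) (x : Fin d → ℝ) : Cell d :=
  T.leafFrom x (Cell.root d)

end SplitTree

/-! ### Weighted counts and the weighted tree predictor -/

section Counts

variable {m d : ℕ}

/-- Total weight of the observations falling into the leaf `L`. -/
noncomputable def leafWeight (L : Cell d) (w : Fin m → ℝ) (x : Fin m → Fin d → ℝ) : ℝ :=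
  ∑ i, w i * L.toSet.indicator 1 (x i)

/-- Total weight of the observations whose `j`-th coordinate falls into the `j`-th interval
of `L`. -/
noncomputable def sideWeight (L : Cell d) (j : Fin d) (w : Fin m → ℝ)
    (x : Fin m → Fin d → ℝ) : ℝ :=
  ∑ i, w i * (L.side j).indicator 1 (x i j)

/-- The weighted average of the responses in the leaf `L`. -/
noncomputable def leafAverage (L : Cell d) (w : Fin m → ℝ) (x : Fin m → Fin d → ℝ)
    (y : Fin m → ℝ) : ℝ :=
  ∑ i, w i * L.toSet.indicator 1 (x i) / leafWeight L w x * y i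

end Counts

/-! ### Moments of a weight vector

These are moments of the first one or two weights `W₁, W₂`; the value `0` for a vector that has
no such entries is never relevant, as the statements concern vectors of length tending to
infinity. -/

section Moments

variable {Ω : Type*} [MeasurableSpace Ω] {m : ℕ}

/-- `E[W₁]`. -/
noncomputable def meanWeight (P : Measure Ω) (W : Fin m → Ω → ℝ) : ℝ :=
  if h : 0 < m then ∫ ω, W ⟨0, h⟩ ω ∂P else 0

/-- `E[W₁²]`. -/
noncomputable def secondMoment (P : Measure Ω) (W : Fin m → Ω → ℝ) : ℝ :=
  if h : 0 < m then ∫ ω, W ⟨0, h⟩ ω ^ 2 ∂P else 0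

/-- `E[W₁ W₂]`. -/
noncomputable def mixedMoment (P : Measure Ω) (W : Fin m → Ω → ℝ) : ℝ :=
  if h : 1 < m then ∫ ω, W ⟨0, by omega⟩ ω * W ⟨1, h⟩ ω ∂P else 0

/-- `E[(W₁ / E[W₁] - 1) (W₂ / E[W₁] - 1)]`. -/
noncomputable def adjustedMixedMoment (P : Measure Ω) (W : Fin m → Ω → ℝ) : ℝ :=
  if h : 1 < m then
    ∫ ω, (W ⟨0, by omega⟩ ω / meanWeight P W - 1) * (W ⟨1, h⟩ ω / meanWeight P W - 1) ∂P
  else 0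

/-- The law of the vector `W` is invariant under permutations of the indices. -/
def Exchangeable (P : Measure Ω) (W : Fin m → Ω → ℝ) : Prop :=
  ∀ σ : Equiv.Perm (Fin m),
    P.map (fun ω i => W (σ i) ω) = P.map (fun ω i => W i ω)

end Moments

/-! ### The honest bootstrap tree -/

/-- The random variables and the growing rule that make up a sequence of honest bootstrap trees:
observations `(X i, Y i)`, a partition of the first `n` of them into a prediction part (of size
`nI n`) and a growing part (of size `nJ n`), bootstrap weights `WI n`, `WJ n` for the two parts,
and a rule that grows a tree from the auxiliary parameter `θ`, the growing part and its weights,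
and from nothing else. -/
structure Scheme (Ω : Type*) [MeasurableSpace Ω] (Θ : Type*) [MeasurableSpace Θ] (d : ℕ) where
  X : ℕ → Ω → Fin d → ℝ
  Y : ℕ → Ω → ℝ
  θ : Ω → Θ
  nI : ℕ → ℕ
  nJ : ℕ → ℕ
  /-- the deterministic partition of the first `n` observations -/
  part : ∀ n, Fin (nI n) ⊕ Fin (nJ n) ≃ Fin n
  WI : ∀ n, Fin (nI n) → Ω → ℝ
  WJ : ∀ n, Fin (nJ n) → Ω → ℝ
  grow : ∀ n, Θ × (Fin (nJ n) → (Fin d → ℝ) × ℝ) × (Fin (nJ n) → ℝ) → SplitTree d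
  measurable_X : ∀ i, Measurable (X i)
  measurable_Y : ∀ i, Measurable (Y i)
  measurable_θ : Measurable θ
  measurable_WI : ∀ n i, Measurable (WI n i)
  measurable_WJ : ∀ n i, Measurable (WJ n i)
  splitsWithin_grow : ∀ n p, (grow n p).SplitsWithin (Cell.root d)
  measurable_lower : ∀ n x j, Measurable fun p => ((grow n p).leafAt x).lower j
  measurable_upper : ∀ n x j, Measurable fun p => ((grow n p).leafAt x).upper j

namespace Scheme

variable {Ω : Type*} [MeasurableSpace Ω] {Θ : Type*} [MeasurableSpace Θ] {d : ℕ}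

/-- The first `n` observations. -/
def data (S : Scheme Ω Θ d) (n : ℕ) (ω : Ω) : Fin n → (Fin d → ℝ) × ℝ :=
  fun i => (S.X i ω, S.Y i ω)

/-- The features in the prediction part. -/
def XI (S : Scheme Ω Θ d) (n : ℕ) (ω : Ω) : Fin (S.nI n) → Fin d → ℝ :=
  fun i => (S.data n ω (S.part n (Sum.inl i))).1

/-- The responses in the prediction part. -/
def YI (S : Scheme Ω Θ d) (n : ℕ) (ω : Ω) : Fin (S.nI n) → ℝ :=
  fun i => (S.data n ω (S.part n (Sum.inl i))).2

/-- The growing part. -/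
def growData (S : Scheme Ω Θ d) (n : ℕ) (ω : Ω) : Fin (S.nJ n) → (Fin d → ℝ) × ℝ :=
  fun i => S.data n ω (S.part n (Sum.inr i))

/-- The leaf `L*(x, θ)` of the tree grown on the bootstrapped growing part. -/
noncomputable def leaf (S : Scheme Ω Θ d) (n : ℕ) (x : Fin d → ℝ) (ω : Ω) : Cell d :=
  (S.grow n (S.θ ω, S.growData n ω, fun i => S.WJ n i ω)).leafAt x

/-- `N_L^*(x, θ)`. -/
noncomputable def leafCount (S : Scheme Ω Θ d) (n : ℕ) (x : Fin d → ℝ) (ω : Ω) : ℝ :=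
  leafWeight (S.leaf n x ω) (fun i => S.WI n i ω) (S.XI n ω)

/-- `N_L^{j,*}(x, θ)`. -/
noncomputable def sideCount (S : Scheme Ω Θ d) (n : ℕ) (j : Fin d) (x : Fin d → ℝ) (ω : Ω) : ℝ :=
  sideWeight (S.leaf n x ω) j (fun i => S.WI n i ω) (S.XI n ω)

/-- The bootstrap tree predictor `T*(x, θ)`. -/
noncomputable def predictor (S : Scheme Ω Θ d) (n : ℕ) (x : Fin d → ℝ) (ω : Ω) : ℝ :=
  leafAverage (S.leaf n x ω) (fun i => S.WI n i ω) (S.XI n ω) (S.YI n ω)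

/-- `n_I E[W₁]`, the expected size of the bootstrapped prediction part. -/
noncomputable def effectiveSize (S : Scheme Ω Θ d) (P : Measure Ω) (n : ℕ) : ℝ :=
  S.nI n * meanWeight P (S.WI n)

end Scheme

/-! ### Assumptions -/

section Assumptions

variable {Ω : Type*} [MeasurableSpace Ω] {Θ : Type*} [MeasurableSpace Θ] {d : ℕ}

/-- `X` has a continuous density on `[0,1]^d`, bounded away from zero and infinity, and
`E[Y²] < ∞` with `x ↦ E[Y² | X = x]` continuous and bounded on `[0,1]^d`. -/
structure CovariateAssumption (P : Measure Ω) (X : Ω → Fin d → ℝ) (Y : Ω → ℝ) : Prop where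
  density : ∃ (f : (Fin d → ℝ) → ℝ) (ε C : ℝ), 0 < ε ∧
    ContinuousOn f (unitCube d) ∧ (∀ z ∈ unitCube d, ε ≤ f z ∧ f z ≤ C) ∧
    P.map X = (volume.restrict (unitCube d)).withDensity (fun z => ENNReal.ofReal (f z))
  memLp_Y : MemLp Y 2 P
  second_moment : ∃ (v : (Fin d → ℝ) → ℝ) (K : ℝ),
    ContinuousOn v (unitCube d) ∧ (∀ z ∈ unitCube d, v z ≤ K) ∧
    P[fun ω => Y ω ^ 2 | MeasurableSpace.comap X inferInstance] =ᵐ[P] fun ω => v (X ω)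

/-- `μ` is a version of the regression function `x ↦ E[Y | X = x]`. -/
structure IsRegressionFunction (P : Measure Ω) (X : Ω → Fin d → ℝ) (Y : Ω → ℝ)
    (μ : (Fin d → ℝ) → ℝ) : Prop where
  measurable : Measurable μ
  condExp_eq : P[Y | MeasurableSpace.comap X inferInstance] =ᵐ[P] fun ω => μ (X ω)

/-- The observations are independent and identically distributed. -/
structure IIDObservations (P : Measure Ω) (S : Scheme Ω Θ d) : Prop where
  indep : iIndepFun (fun i ω => (S.X i ω, S.Y i ω)) P
  ident : ∀ i, IdentDistrib (fun ω => (S.X i ω, S.Y i ω)) (fun ω => (S.X 0 ω, S.Y 0 ω)) P P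

/-- Both parts of the data have a size of exact order `n`. (That the trees are grown without
the prediction part is built into `Scheme`.) -/
structure HonestSizes (S : Scheme Ω Θ d) : Prop where
  nI_order : (fun n => (S.nI n : ℝ)) =Θ[atTop] fun n => (n : ℝ)
  nJ_order : (fun n => (S.nJ n : ℝ)) =Θ[atTop] fun n => (n : ℝ)

/-- For each `n`, the prediction weights, the growing weights, the parameter `θ` and the
observations are mutually independent. -/
structure IndependentWeights (P : Measure Ω) (S : Scheme Ω Θ d) : Prop where
  param : ∀ n, IndepFun S.θ (S.data n) P
  growing : ∀ n, IndepFun (fun ω i => S.WJ n i ω) (fun ω => (S.θ ω, S.data n ω)) P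
  prediction : ∀ n, IndepFun (fun ω i => S.WI n i ω)
    (fun ω => ((fun i => S.WJ n i ω), S.θ ω, S.data n ω)) P

/-- Sign, symmetry and moment conditions on a sequence of weight vectors. -/
structure WeightAssumption (P : Measure Ω) {m : ℕ → ℕ} (W : ∀ n, Fin (m n) → Ω → ℝ) : Prop where
  nonneg : ∀ n i, ∀ᵐ ω ∂P, 0 ≤ W n i ω
  exchangeable : ∀ n, Exchangeable P (W n)
  integrable : ∀ n i, Integrable (W n i) P
  memLp : ∀ᶠ n in atTop, ∀ i, MemLp (W n i) 2 P
  mean_bdd : BddAbove (Set.range fun n => meanWeight P (W n))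
  mixed : Tendsto (fun n => mixedMoment P (W n) / meanWeight P (W n) ^ 2) atTop (𝓝 1)
  second : ∃ l : ℝ,
    Tendsto (fun n => secondMoment P (W n) / meanWeight P (W n)) atTop (𝓝 l)

end Assumptions

end BootstrapTree

/-! The error $T^*-\mu(x)$ splits into a bias, at most the oscillation of $\mu$ over the observed
points of the leaf, and a variance term, the weighted residual sum $\sum_i W_i\mathbf 1_{\{X_i\in
L^*\}}(Y_i-\mu(X_i))$ divided by $N_L^*$ (`abs_leafAverage_sub_le`).

Both are controlled by one second-moment bound, `integral_sq_sum_le`. The leaf enters only through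
its corners, which by honesty are independent of the prediction part. Hence functionals
$g(\text{leaf},Z_i)$ of single observations $Z_i$ that are centred for every fixed leaf are
orthogonal, and since the weights are independent of leaf and data, $\mathbb E(\sum_i W_i g_i)^2$ is
at most a constant times $n_{\mathcal I}\mathbb E[W_1^2]$. Correlation of the weights plays no role
here. Divided by $s^{2\beta}$ with $s=n_{\mathcal I}\mathbb E[W_1]$, this is of order $(\mathbb
E[W_1^2]/\mathbb E[W_1])\,s^{1-2\beta}$, which vanishes for $\beta>1/2$.

With $g$ the residual in the leaf, the variance term is negligible on $\{N_L^*\ge k_n\}$. With $g$ a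
centred slab indicator and exponent $1$, $N_L^{j,*}/s$ differs negligibly from the total weight over
$s$ times the mass of the slab. That ratio of weights tends to $1$ (`tendstoInMeasure_total`), so
the slab mass tends to $0$. As the density is at least $\varepsilon$, the sides of the leaf shrink,
and continuity of $\mu$ at $x$ removes the bias. -/

namespace BootstrapTree

/-! ### Second moments and independence -/

section General

variable {Ω : Type*} [MeasurableSpace Ω] {P : Measure Ω}

/-- Chebyshev's inequality along a sequence. -/
theorem tendstoInMeasure_zero_of_integral_sq_le [IsProbabilityMeasure P] {R : ℕ → Ω → ℝ}
    {b : ℕ → ℝ} (hR : ∀ᶠ n in atTop, Integrable (fun ω => R n ω ^ 2) P ∧ ∫ ω, R n ω ^ 2 ∂P ≤ b n)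
    (hb : Tendsto b atTop (𝓝 0)) : TendstoInMeasure P R atTop fun _ => 0 := by
  rw [tendstoInMeasure_iff_measureReal_norm]
  intro δ hδ
  refine tendsto_of_tendsto_of_tendsto_of_le_of_le' tendsto_const_nhds
    (by simpa using hb.div_const (δ ^ 2)) (.of_forall fun _ => measureReal_nonneg) ?_
  filter_upwards [hR] with n hn
  rw [le_div_iff₀ (by positivity), mul_comm]
  have h := mul_meas_ge_le_integral_of_nonneg (ae_of_all P fun ω => sq_nonneg (R n ω)) hn.1 (δ ^ 2)
  refine le_trans (le_of_eq ?_) (h.trans hn.2)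
  congr 2
  ext ω
  simp only [sub_zero, Real.norm_eq_abs, Set.mem_ofPred_eq]
  rw [← sq_abs (R n ω)]
  exact (pow_le_pow_iff_left₀ hδ.le (abs_nonneg _) two_ne_zero).symm

/-- The law of the triple is a product of three marginals, and a product measure may be
re-bracketed. This is how `θ` and the growing weights are adjoined one at a time to the left factor.
-/
theorem indepFun_prodMk_of_indepFun [IsProbabilityMeasure P] {α β γ : Type*} [MeasurableSpace α]
    [MeasurableSpace β] [MeasurableSpace γ] {f : Ω → α} {g : Ω → β} {h : Ω → γ}
    (hf : Measurable f) (hg : Measurable g) (hh : Measurable h)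
    (hfgh : IndepFun f (fun ω => (g ω, h ω)) P) (hgh : IndepFun g h P) :
    IndepFun (fun ω => (f ω, g ω)) h P := by
  have hfg : IndepFun f g P := hfgh.comp measurable_id measurable_fst
  have := Measure.isProbabilityMeasure_map (μ := P) hf.aemeasurable
  have := Measure.isProbabilityMeasure_map (μ := P) hg.aemeasurable
  have := Measure.isProbabilityMeasure_map (μ := P) hh.aemeasurable
  rw [indepFun_iff_map_prod_eq_prod_map_map (hf.prodMk hg).aemeasurable hh.aemeasurable,
    hfg.map_prod_eq_prod_map_map hf.aemeasurable hg.aemeasurable]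
  have h1 := hfgh.map_prod_eq_prod_map_map hf.aemeasurable (hg.prodMk hh).aemeasurable
  rw [hgh.map_prod_eq_prod_map_map hg.aemeasurable hh.aemeasurable, ← Measure.prodAssoc_prod] at h1
  have h2 := congrArg (Measure.map MeasurableEquiv.prodAssoc.symm) h1
  rw [Measure.map_map (by fun_prop) (by fun_prop), Measure.map_map (by fun_prop) (by fun_prop)] at h2
  rw [MeasurableEquiv.symm_comp_self, Measure.map_id] at h2
  exact h2

/-- Two centred functionals of independent observations stay orthogonal if they share an
independent random parameter `q`. -/
theorem integral_mul_eq_zero_of_indepFun [IsProbabilityMeasure P] {Q E : Type*}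
    [MeasurableSpace Q] [MeasurableSpace E] {q : Ω → Q} {Z Z' : Ω → E} (hq : Measurable q)
    (hZ : Measurable Z) (hZ' : Measurable Z') (hind : IndepFun (fun ω => (q ω, Z' ω)) Z P)
    {g : Q × E → ℝ} (hg : Measurable g) (h0 : ∀ u, ∫ z, g (u, z) ∂(P.map Z) = 0)
    (hint : Integrable (fun ω => g (q ω, Z' ω) * g (q ω, Z ω)) P) :
    ∫ ω, g (q ω, Z' ω) * g (q ω, Z ω) ∂P = 0 := by
  have := Measure.isProbabilityMeasure_map (μ := P) hZ.aemeasurable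
  have := Measure.isProbabilityMeasure_map (μ := P) (hq.prodMk hZ').aemeasurable
  have hm := hind.map_prod_eq_prod_map_map (hq.prodMk hZ').aemeasurable hZ.aemeasurable
  -- Under the product law, `Z` is integrated out first with `(q, Z')` frozen; the factor in `Z'` is
  -- then a constant and `h0` kills the inner integral.
  let G : (Q × E) × E → ℝ := fun t => g t.1 * g (t.1.1, t.2)
  have hG : Measurable G := by fun_prop
  have hT : Measurable fun ω => ((q ω, Z' ω), Z ω) := by fun_prop
  have h1 : ∫ ω, g (q ω, Z' ω) * g (q ω, Z ω) ∂P
      = ∫ t, G t ∂(P.map fun ω => ((q ω, Z' ω), Z ω)) :=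
    (integral_map hT.aemeasurable hG.aestronglyMeasurable).symm
  have h2 : Integrable G (P.map fun ω => ((q ω, Z' ω), Z ω)) :=
    (integrable_map_measure hG.aestronglyMeasurable hT.aemeasurable).2 hint
  rw [hm] at h1 h2
  rw [h1, integral_prod _ h2]
  simp [G, integral_const_mul, h0]

/-- The second moment of a weighted sum of orthogonal variables with independent weights. -/
theorem integral_sq_sum_mul_of_orthogonal [IsProbabilityMeasure P] {m : ℕ}
    {W ξ : Fin m → Ω → ℝ} (hW : ∀ i, MemLp (W i) 2 P) (hξ : ∀ i, MemLp (ξ i) 2 P)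
    (hind : IndepFun (fun ω i => W i ω) (fun ω i => ξ i ω) P)
    (horth : ∀ i j, i ≠ j → ∫ ω, ξ i ω * ξ j ω ∂P = 0) :
    Integrable (fun ω => (∑ i, W i ω * ξ i ω) ^ 2) P ∧
      ∫ ω, (∑ i, W i ω * ξ i ω) ^ 2 ∂P = ∑ i, (∫ ω, W i ω ^ 2 ∂P) * ∫ ω, ξ i ω ^ 2 ∂P := by
  have hij : ∀ i j, IndepFun (fun ω => W i ω * W j ω) (fun ω => ξ i ω * ξ j ω) P := fun i j =>
    hind.comp (φ := fun u : Fin m → ℝ => u i * u j) (ψ := fun u : Fin m → ℝ => u i * u j)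
      (by fun_prop) (by fun_prop)
  have hWW : ∀ i j, Integrable (fun ω => W i ω * W j ω) P := fun i j => (hW i).integrable_mul (hW j)
  have hξξ : ∀ i j, Integrable (fun ω => ξ i ω * ξ j ω) P := fun i j => (hξ i).integrable_mul (hξ j)
  have hint : ∀ i j, Integrable (fun ω => (W i ω * W j ω) * (ξ i ω * ξ j ω)) P := fun i j =>
    (hij i j).integrable_mul (hWW i j) (hξξ i j)
  have hexp : ∀ ω, (∑ i, W i ω * ξ i ω) ^ 2
      = ∑ i, ∑ j, (W i ω * W j ω) * (ξ i ω * ξ j ω) := fun ω => by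
    rw [sq, Finset.sum_mul_sum]
    exact Finset.sum_congr rfl fun i _ => Finset.sum_congr rfl fun j _ => by ring
  simp_rw [hexp]
  refine ⟨integrable_finsetSum _ fun i _ => integrable_finsetSum _ fun j _ => hint i j, ?_⟩
  rw [integral_finsetSum _ fun i _ => integrable_finsetSum _ fun j _ => hint i j]
  refine Finset.sum_congr rfl fun i _ => ?_
  rw [integral_finsetSum _ fun j _ => hint i j, Finset.sum_eq_single i]
  · rw [(hij i i).integral_fun_mul_eq_mul_integral (hWW i i).1 (hξξ i i).1]
    simp [sq]
  -- Off-diagonal terms vanish through the `ξ` factor, whatever the correlation of the weights.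
  · intro j _ hji
    rw [(hij i j).integral_fun_mul_eq_mul_integral (hWW i j).1 (hξξ i j).1, horth i j hji.symm,
      mul_zero]
  · simp

end General

/-! ### Moments of exchangeable weights -/

section Exchangeability

variable {Ω : Type*} [MeasurableSpace Ω] {P : Measure Ω} {m : ℕ} {W : Fin m → Ω → ℝ}

theorem Exchangeable.integral_comp_perm (h : Exchangeable P W) (hW : ∀ i, Measurable (W i))
    (σ : Equiv.Perm (Fin m)) {φ : (Fin m → ℝ) → ℝ} (hφ : Measurable φ) :
    ∫ ω, φ (fun i => W (σ i) ω) ∂P = ∫ ω, φ (fun i => W i ω) ∂P := by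
  rw [← integral_map (φ := fun ω i => W (σ i) ω) (by fun_prop) hφ.aestronglyMeasurable,
    ← integral_map (φ := fun ω i => W i ω) (by fun_prop) hφ.aestronglyMeasurable, h σ]

theorem Exchangeable.integral_eq_meanWeight (h : Exchangeable P W) (hW : ∀ i, Measurable (W i))
    (i : Fin m) : ∫ ω, W i ω ∂P = meanWeight P W := by
  have hm : 0 < m := i.pos
  have := h.integral_comp_perm hW (Equiv.swap ⟨0, hm⟩ i) (φ := fun u => u ⟨0, hm⟩) (by fun_prop)
  simpa [meanWeight, hm] using this

theorem Exchangeable.integral_sq_eq_secondMoment (h : Exchangeable P W)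
    (hW : ∀ i, Measurable (W i)) (i : Fin m) : ∫ ω, W i ω ^ 2 ∂P = secondMoment P W := by
  have hm : 0 < m := i.pos
  have := h.integral_comp_perm hW (Equiv.swap ⟨0, hm⟩ i) (φ := fun u => u ⟨0, hm⟩ ^ 2)
    (by fun_prop)
  simpa [secondMoment, hm] using this

theorem Exchangeable.integral_mul_eq_mixedMoment (h : Exchangeable P W)
    (hW : ∀ i, Measurable (W i)) {i j : Fin m} (hij : i ≠ j) :
    ∫ ω, W i ω * W j ω ∂P = mixedMoment P W := by
  have hm : 1 < m := by
    have := Fin.val_ne_of_ne hij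
    omega
  let a : Fin m := ⟨0, by omega⟩
  let b : Fin m := ⟨1, hm⟩
  let τ := Equiv.swap a i
  have hab : a ≠ b := by simp [a, b]
  -- The permutation sought sends `a` to `i` and `b` to `j`. Swapping `b` with `τ j` before applying
  -- `τ` does this, provided the first swap leaves `a` alone.
  have haj : a ≠ τ j := fun e => hij (τ.injective (by rw [← e]; simp [τ]))
  have := h.integral_comp_perm hW ((Equiv.swap b (τ j)).trans τ) (φ := fun u => u a * u b)
    (by fun_prop)
  have h1 : Equiv.swap b (τ j) a = a := Equiv.swap_apply_of_ne_of_ne hab haj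
  simp only [Equiv.trans_apply, h1, Equiv.swap_apply_left] at this
  have h2 : τ a = i := by simp [τ]
  have h3 : τ (τ j) = j := by simp [τ]
  rw [h2, h3] at this
  rw [this, mixedMoment, dif_pos hm]

/-- The second moment of the normalized total weight. -/
theorem Exchangeable.integral_sq_sum_div_sub_one [IsProbabilityMeasure P] (h : Exchangeable P W)
    (hW : ∀ i, Measurable (W i)) (hL : ∀ i, MemLp (W i) 2 P) (hm : 0 < m * meanWeight P W) :
    Integrable (fun ω => ((∑ i, W i ω) / (m * meanWeight P W) - 1) ^ 2) P ∧
      ∫ ω, ((∑ i, W i ω) / (m * meanWeight P W) - 1) ^ 2 ∂P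
        = secondMoment P W / meanWeight P W / (m * meanWeight P W)
          + (1 - 1 / (m : ℝ)) * (mixedMoment P W / meanWeight P W ^ 2) - 1 := by
  set e := meanWeight P W
  have hi : ∀ i, Integrable (W i) P := fun i => (hL i).integrable (by norm_num)
  have hWW : ∀ i j, Integrable (fun ω => W i ω * W j ω) P := fun i j => (hL i).integrable_mul (hL j)
  have hS : Integrable (fun ω => ∑ i, W i ω) P := integrable_finsetSum _ fun i _ => hi i
  have hSS : Integrable (fun ω => ∑ i, ∑ j, W i ω * W j ω) P :=
    integrable_finsetSum _ fun i _ => integrable_finsetSum _ fun j _ => hWW i j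
  have h1 : ∫ ω, ∑ i, W i ω ∂P = m * e := by
    rw [integral_finsetSum _ fun i _ => hi i]
    simp [h.integral_eq_meanWeight hW, e]
  have h2 : ∫ ω, ∑ i, ∑ j, W i ω * W j ω ∂P
      = m * (secondMoment P W + (m - 1) * mixedMoment P W) := by
    rw [integral_finsetSum _ fun i _ => integrable_finsetSum _ fun j _ => hWW i j]
    have : ∀ i : Fin m, ∫ ω, ∑ j, W i ω * W j ω ∂P
        = secondMoment P W + (m - 1) * mixedMoment P W := fun i => by
      rw [integral_finsetSum _ fun j _ => hWW i j, ← Finset.add_sum_erase _ _ (Finset.mem_univ i),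
        Finset.sum_congr rfl fun j hj =>
          h.integral_mul_eq_mixedMoment hW (Finset.ne_of_mem_erase hj).symm]
      have := h.integral_sq_eq_secondMoment hW i
      simp only [sq] at this
      rw [this, Finset.sum_const, Finset.card_erase_of_mem (Finset.mem_univ i), Finset.card_univ,
        Fintype.card_fin, nsmul_eq_mul, Nat.cast_sub i.pos, Nat.cast_one]
    simp only [this, Finset.sum_const, Finset.card_univ, Fintype.card_fin, nsmul_eq_mul]
  have hexp : ∀ ω, ((∑ i, W i ω) / (m * e) - 1) ^ 2 = 1 / (m * e) ^ 2 * ∑ i, ∑ j, W i ω * W j ω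
      - 2 / (m * e) * ∑ i, W i ω + 1 := fun ω => by
    rw [← Finset.sum_mul_sum]
    ring
  have hA := hSS.const_mul (1 / (m * e) ^ 2)
  have hB := hS.const_mul (2 / (m * e))
  simp_rw [hexp]
  have hAB : Integrable (fun ω => 1 / (m * e) ^ 2 * ∑ i, ∑ j, W i ω * W j ω
      - 2 / (m * e) * ∑ i, W i ω) P := hA.sub hB
  refine ⟨hAB.add (integrable_const 1), ?_⟩
  rw [integral_add hAB (integrable_const 1), integral_sub hA hB, integral_const_mul,
    integral_const_mul, h1, h2]
  have hm0 : (m : ℝ) ≠ 0 := fun h0 => by simp [h0] at hm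
  have he0 : e ≠ 0 := fun h0 => by simp [h0] at hm
  simp only [integral_const, probReal_univ, smul_eq_mul]
  field_simp
  ring

end Exchangeability

/-! ### Geometry of leaves and the bias-variance split -/

section Deterministic

variable {d m : ℕ}

/-- Routing keeps `x` between the corners, and thresholds inside the node keep children inside their
parent. The bounds on `x` are closed because a point with a zero coordinate lies outside the
half-open root box. -/
theorem SplitTree.leafFrom_bounds {x : Fin d → ℝ} (T : SplitTree d) (A : Cell d)
    (hT : T.SplitsWithin A) (hA : ∀ j, A.lower j ≤ x j ∧ x j ≤ A.upper j) (j : Fin d) :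
    A.lower j ≤ (T.leafFrom x A).lower j ∧ (T.leafFrom x A).lower j ≤ x j ∧
      x j ≤ (T.leafFrom x A).upper j ∧ (T.leafFrom x A).upper j ≤ A.upper j := by
  induction T generalizing A with
  | leaf => exact ⟨le_rfl, (hA j).1, (hA j).2, le_rfl⟩
  | node k c l r ihl ihr =>
    obtain ⟨hc, hl, hr⟩ := hT
    rw [SplitTree.leafFrom]
    split_ifs with h
    · obtain ⟨h1, h2, h3, h4⟩ := ihl (A.left k c) hl fun i => by
        refine ⟨(hA i).1, ?_⟩
        by_cases hi : i = k
        · subst hi; simpa [Cell.left] using h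
        · simpa [Cell.left, hi] using (hA i).2
      refine ⟨h1, h2, h3, h4.trans ?_⟩
      by_cases hj : j = k
      · subst hj; simpa [Cell.left] using hc.2
      · simp [Cell.left, hj]
    · obtain ⟨h1, h2, h3, h4⟩ := ihr (A.right k c) hr fun i => by
        refine ⟨?_, (hA i).2⟩
        by_cases hi : i = k
        · subst hi; simpa [Cell.right] using (not_le.1 h).le
        · simpa [Cell.right, hi] using (hA i).1
      refine ⟨le_trans ?_ h1, h2, h3, h4⟩
      by_cases hj : j = k
      · subst hj; simpa [Cell.right] using hc.1
      · simp [Cell.right, hj]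

/-- Bias-variance decomposition of a weighted average with respect to a centring function `μ`. -/
theorem abs_leafAverage_sub_le {L : Cell d} {w : Fin m → ℝ} {z : Fin m → Fin d → ℝ} {y : Fin m → ℝ}
    {μ : (Fin d → ℝ) → ℝ} {a r : ℝ} (hw : ∀ i, 0 ≤ w i) (hN : 0 < leafWeight L w z)
    (hμ : ∀ i, z i ∈ L.toSet → |μ (z i) - a| ≤ r) :
    |leafAverage L w z y - a| ≤
      |∑ i, w i * (L.toSet.indicator 1 (z i) * (y i - μ (z i)))| / leafWeight L w z + r := by
  set N := leafWeight L w z with hNdef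
  have hbias : |∑ i, w i * L.toSet.indicator 1 (z i) * (μ (z i) - a)| ≤ r * N := by
    refine (Finset.abs_sum_le_sum_abs _ _).trans ?_
    rw [hNdef, leafWeight, Finset.mul_sum]
    refine Finset.sum_le_sum fun i _ => ?_
    by_cases hi : z i ∈ L.toSet
    · simpa [hi, abs_mul, abs_of_nonneg (hw i), mul_comm] using
        mul_le_mul_of_nonneg_left (hμ i hi) (hw i)
    · simp [hi]
  have hdec : leafAverage L w z y - a
      = (∑ i, w i * (L.toSet.indicator 1 (z i) * (y i - μ (z i)))
        + ∑ i, w i * L.toSet.indicator 1 (z i) * (μ (z i) - a)) / N := by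
    have h1 : leafAverage L w z y * N = ∑ i, w i * L.toSet.indicator 1 (z i) * y i := by
      rw [leafAverage, Finset.sum_mul]
      refine Finset.sum_congr rfl fun i _ => ?_
      rw [← hNdef]
      field_simp
    have h2 : a * N = ∑ i, a * (w i * L.toSet.indicator 1 (z i)) := by
      rw [hNdef, leafWeight, Finset.mul_sum]
    rw [eq_div_iff hN.ne', sub_mul, h1, h2, ← Finset.sum_add_distrib, ← Finset.sum_sub_distrib]
    exact Finset.sum_congr rfl fun i _ => by ring
  rw [hdec, abs_div, abs_of_pos hN, div_add' _ _ _ hN.ne']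
  gcongr
  exact (abs_add_le _ _).trans (by gcongr)

end Deterministic

/-! ### Mass of a slab -/

section Density

variable {d : ℕ}

/-- The part of the slab inside the cube contains a box of volume $b-a$ (if $a\le b$) on which the
density is at least `ε`. This turns small mass into a short side. -/
theorem mul_sub_le_measureReal_slab {f : (Fin d → ℝ) → ℝ} {ε : ℝ} (hε : 0 < ε)
    (hf : ∀ z ∈ unitCube d, ε ≤ f z) {ν : Measure (Fin d → ℝ)} [IsProbabilityMeasure ν]
    (hν : ν = (volume.restrict (unitCube d)).withDensity fun z => ENNReal.ofReal (f z))
    (j : Fin d) {a b : ℝ} (ha : 0 ≤ a) (hb : b ≤ 1) :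
    ε * (b - a) ≤ ν.real {z | z j ∈ Set.Ioc a b} := by
  have hcube : MeasurableSet (unitCube d) := measurableSet_Icc
  let B : Set (Fin d → ℝ) := Set.univ.pi fun i => if i = j then Set.Ioc a b else Set.Icc 0 1
  have hB : MeasurableSet B := MeasurableSet.univ_pi fun i => by
    split_ifs
    exacts [measurableSet_Ioc, measurableSet_Icc]
  have hBs : B ⊆ {z | z j ∈ Set.Ioc a b} := fun z hz => by simpa using hz j (Set.mem_univ j)
  have hBc : B ⊆ unitCube d := fun z hz => by
    have : ∀ i, z i ∈ Set.Icc (0 : ℝ) 1 := fun i => by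
      have h := hz i (Set.mem_univ i)
      dsimp only at h
      split_ifs at h
      exacts [⟨ha.trans h.1.le, h.2.trans hb⟩, h]
    exact ⟨fun i => (this i).1, fun i => (this i).2⟩
  have hvol : volume B = ENNReal.ofReal (b - a) := by
    rw [volume_pi_pi, Finset.prod_eq_single j]
    · simp
    · intro i _ hi
      simp [hi]
    · simp
  have hle : ENNReal.ofReal (ε * (b - a)) ≤ ν {z | z j ∈ Set.Ioc a b} := by
    refine le_trans ?_ (measure_mono hBs)
    rw [hν, withDensity_apply _ hB, Measure.restrict_restrict hB, Set.inter_eq_left.2 hBc,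
      ENNReal.ofReal_mul hε.le, ← hvol, ← setLIntegral_const]
    exact setLIntegral_mono' hB fun z hz => ENNReal.ofReal_le_ofReal (hf z (hBc hz))
  exact (ENNReal.ofReal_le_iff_le_toReal (measure_ne_top _ _)).1 hle

end Density

/-! ### Honesty: independence of leaf, weights and observations -/

namespace Scheme

variable {Ω : Type*} [MeasurableSpace Ω] {Θ : Type*} [MeasurableSpace Θ] {d : ℕ}
  (S : Scheme Ω Θ d) {P : Measure Ω}

/-- The lower and upper corner of the leaf `L*(x, θ)`. -/
noncomputable def corners (n : ℕ) (x : Fin d → ℝ) (ω : Ω) : (Fin d → ℝ) × (Fin d → ℝ) :=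
  ((S.leaf n x ω).lower, (S.leaf n x ω).upper)

/-- The `i`-th observation of the prediction part. -/
def obs (n : ℕ) (i : Fin (S.nI n)) (ω : Ω) : (Fin d → ℝ) × ℝ :=
  S.data n ω (S.part n (Sum.inl i))

theorem measurable_obs (n : ℕ) (i : Fin (S.nI n)) : Measurable (S.obs n i) :=
  (S.measurable_X _).prodMk (S.measurable_Y _)

theorem measurable_growData (n : ℕ) : Measurable (S.growData n) :=
  measurable_pi_lambda _ fun _ => (S.measurable_X _).prodMk (S.measurable_Y _)

theorem measurable_leafAt_corners (n : ℕ) (x : Fin d → ℝ) :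
    Measurable fun p => (((S.grow n p).leafAt x).lower, ((S.grow n p).leafAt x).upper) :=
  (measurable_pi_lambda _ (S.measurable_lower n x)).prodMk
    (measurable_pi_lambda _ (S.measurable_upper n x))

theorem measurable_corners (n : ℕ) (x : Fin d → ℝ) : Measurable (S.corners n x) :=
  (S.measurable_leafAt_corners n x).comp
    (S.measurable_θ.prodMk ((S.measurable_growData n).prodMk
      (measurable_pi_lambda _ (S.measurable_WJ n))))

theorem indepFun_weights_corners_data (h : IndependentWeights P S) (n : ℕ) (x : Fin d → ℝ) :
    IndepFun (fun ω i => S.WI n i ω) (fun ω => (S.corners n x ω, S.data n ω)) P := by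
  let ψ : (Fin (S.nJ n) → ℝ) × Θ × (Fin n → (Fin d → ℝ) × ℝ) →
      ((Fin d → ℝ) × (Fin d → ℝ)) × (Fin n → (Fin d → ℝ) × ℝ) := fun t =>
    let p := (t.2.1, (fun i => t.2.2 (S.part n (Sum.inr i))), t.1)
    ((((S.grow n p).leafAt x).lower, ((S.grow n p).leafAt x).upper), t.2.2)
  have hψ : Measurable ψ :=
    ((S.measurable_leafAt_corners n x).comp (by fun_prop :
      Measurable fun t : (Fin (S.nJ n) → ℝ) × Θ × (Fin n → (Fin d → ℝ) × ℝ) =>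
        (t.2.1, (fun i => t.2.2 (S.part n (Sum.inr i))), t.1))).prodMk (by fun_prop)
  exact (h.prediction n).comp measurable_id hψ

/-- The corners depend on `θ`, the growing data and the growing weights only. The growing data and
the observation `j` avoid the index of observation `i`, and `θ` and the growing weights are
independent of all data. Keeping observation `j` beside the corners is what the orthogonality of the
summands requires. -/
theorem indepFun_corners_obs [IsProbabilityMeasure P] (hiid : IIDObservations P S)
    (h : IndependentWeights P S) (n : ℕ) (x : Fin d → ℝ) {i j : Fin (S.nI n)} (hij : i ≠ j) :
    IndepFun (fun ω => (S.corners n x ω, S.obs n j ω)) (S.obs n i) P := by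
  classical
  have hdata : iIndepFun (fun (k : Fin n) ω => S.data n ω k) P :=
    hiid.indep.precomp Fin.val_injective
  have hmeas : ∀ k : Fin n, Measurable fun ω => S.data n ω k := fun k =>
    (S.measurable_X k).prodMk (S.measurable_Y k)
  let k := S.part n (Sum.inl i)
  let T : Finset (Fin n) := {k}ᶜ
  have hk : ∀ s, s ≠ Sum.inl i → S.part n s ∈ T := fun s hs => by
    simpa [T, k] using hs
  have h1 := hdata.indepFun_finset T {k} (by simp [T]) hmeas
  let A : Ω → (Fin (S.nJ n) → (Fin d → ℝ) × ℝ) × ((Fin d → ℝ) × ℝ) :=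
    fun ω => (S.growData n ω, S.obs n j ω)
  have hA : Measurable A := (S.measurable_growData n).prodMk (S.measurable_obs n j)
  have hAB : IndepFun A (S.obs n i) P :=
    h1.comp (φ := fun u : T → (Fin d → ℝ) × ℝ =>
        ((fun l => u ⟨S.part n (Sum.inr l), hk _ (by simp)⟩ :
          Fin (S.nJ n) → (Fin d → ℝ) × ℝ), u ⟨S.part n (Sum.inl j), hk _ (by simp [hij.symm])⟩))
      (ψ := fun u : ({k} : Finset (Fin n)) → (Fin d → ℝ) × ℝ => u ⟨k, by simp⟩)
      (by fun_prop) (by fun_prop)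
  have hθ : IndepFun (fun ω => (S.θ ω, A ω)) (S.obs n i) P := by
    refine indepFun_prodMk_of_indepFun S.measurable_θ hA (S.measurable_obs n i) ?_ hAB
    exact (h.param n).comp (φ := id) (ψ := fun u : Fin n → (Fin d → ℝ) × ℝ =>
      (((fun l => u (S.part n (Sum.inr l)) : Fin (S.nJ n) → (Fin d → ℝ) × ℝ),
        u (S.part n (Sum.inl j))), u (S.part n (Sum.inl i)))) measurable_id (by fun_prop)
  have hJ : IndepFun (fun ω => ((fun l => S.WJ n l ω : Fin (S.nJ n) → ℝ), S.θ ω, A ω))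
      (S.obs n i) P := by
    refine indepFun_prodMk_of_indepFun (measurable_pi_lambda _ (S.measurable_WJ n))
      (S.measurable_θ.prodMk hA) (S.measurable_obs n i) ?_ hθ
    exact (h.growing n).comp (φ := id) (ψ := fun u : Θ × (Fin n → (Fin d → ℝ) × ℝ) =>
      ((u.1, ((fun l => u.2 (S.part n (Sum.inr l)) : Fin (S.nJ n) → (Fin d → ℝ) × ℝ),
        u.2 (S.part n (Sum.inl j)))), u.2 (S.part n (Sum.inl i)))) measurable_id (by fun_prop)
  let ψ : (Fin (S.nJ n) → ℝ) × Θ × ((Fin (S.nJ n) → (Fin d → ℝ) × ℝ) × ((Fin d → ℝ) × ℝ)) →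
      ((Fin d → ℝ) × (Fin d → ℝ)) × ((Fin d → ℝ) × ℝ) := fun t =>
    let p := (t.2.1, t.2.2.1, t.1)
    ((((S.grow n p).leafAt x).lower, ((S.grow n p).leafAt x).upper), t.2.2.2)
  have hψ : Measurable ψ :=
    ((S.measurable_leafAt_corners n x).comp (by fun_prop :
      Measurable fun t : (Fin (S.nJ n) → ℝ) × Θ ×
          ((Fin (S.nJ n) → (Fin d → ℝ) × ℝ) × ((Fin d → ℝ) × ℝ)) =>
        (t.2.1, t.2.2.1, t.1))).prodMk (by fun_prop)
  exact hJ.comp hψ measurable_id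

theorem identDistrib_obs (hiid : IIDObservations P S) (n : ℕ) (i : Fin (S.nI n)) :
    IdentDistrib (S.obs n i) (fun ω => (S.X 0 ω, S.Y 0 ω)) P P :=
  hiid.ident _

/-- The second moment of a weighted sum of centred functionals of the leaf and the single
observations. -/
theorem integral_sq_sum_le [IsProbabilityMeasure P] (hiid : IIDObservations P S)
    (hindep : IndependentWeights P S) (hW : WeightAssumption P S.WI) {n : ℕ}
    (hL : ∀ i, MemLp (S.WI n i) 2 P) (x : Fin d → ℝ)
    {g : ((Fin d → ℝ) × (Fin d → ℝ)) × ((Fin d → ℝ) × ℝ) → ℝ} (hg : Measurable g)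
    (h0 : ∀ u, ∫ ω, g (u, S.X 0 ω, S.Y 0 ω) ∂P = 0)
    {B : (Fin d → ℝ) × ℝ → ℝ} (hB : Measurable B)
    (hBL : MemLp (fun ω => B (S.X 0 ω, S.Y 0 ω)) 2 P) (hgB : ∀ u z, |g (u, z)| ≤ |B z|) :
    Integrable (fun ω => (∑ i, S.WI n i ω * g (S.corners n x ω, S.obs n i ω)) ^ 2) P ∧
      ∫ ω, (∑ i, S.WI n i ω * g (S.corners n x ω, S.obs n i ω)) ^ 2 ∂P
        ≤ S.nI n * (secondMoment P (S.WI n) * ∫ ω, B (S.X 0 ω, S.Y 0 ω) ^ 2 ∂P) := by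
  have hq := S.measurable_corners n x
  have hobs := S.measurable_obs n
  have hBi : ∀ i, IdentDistrib (fun ω => B (S.obs n i ω)) (fun ω => B (S.X 0 ω, S.Y 0 ω)) P P :=
    fun i => (S.identDistrib_obs hiid n i).comp hB
  have hBiL : ∀ i, MemLp (fun ω => B (S.obs n i ω)) 2 P := fun i => (hBi i).symm.memLp_snd hBL
  have hξm : ∀ i, Measurable fun ω => g (S.corners n x ω, S.obs n i ω) := fun i =>
    hg.comp (hq.prodMk (hobs i))
  have hξ : ∀ i, MemLp (fun ω => g (S.corners n x ω, S.obs n i ω)) 2 P := fun i =>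
    (hBiL i).mono (hξm i).aestronglyMeasurable (ae_of_all _ fun ω => hgB _ _)
  obtain ⟨h1, h2⟩ := integral_sq_sum_mul_of_orthogonal hL hξ
    ((S.indepFun_weights_corners_data hindep n x).comp measurable_id
      (ψ := fun (u : ((Fin d → ℝ) × (Fin d → ℝ)) × (Fin n → (Fin d → ℝ) × ℝ)) i =>
        g (u.1, u.2 (S.part n (Sum.inl i)))) (by fun_prop))
    fun i j hij => by
      have hz : ∀ u, ∫ z, g (u, z) ∂(P.map (S.obs n j)) = 0 := fun u => by
        rw [(S.identDistrib_obs hiid n j).map_eq, integral_map]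
        · exact h0 u
        · exact ((S.measurable_X 0).prodMk (S.measurable_Y 0)).aemeasurable
        · exact (hg.comp measurable_prodMk_left).aestronglyMeasurable
      exact integral_mul_eq_zero_of_indepFun hq (hobs j) (hobs i)
        (S.indepFun_corners_obs hiid hindep n x hij.symm) hg hz ((hξ i).integrable_mul (hξ j))
  refine ⟨h1, h2.le.trans ?_⟩
  refine (Finset.sum_le_card_nsmul Finset.univ _ (secondMoment P (S.WI n) *
    ∫ ω, B (S.X 0 ω, S.Y 0 ω) ^ 2 ∂P) fun i _ => ?_).trans (by simp)
  rw [(hW.exchangeable n).integral_sq_eq_secondMoment (S.measurable_WI n) i]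
  -- The envelope `B` does not see the leaf, so the bound is uniform over all random leaves.
  refine mul_le_mul_of_nonneg_left ?_ ?_
  · have := ((hBi i).comp (measurable_id.pow_const 2)).integral_eq
    simp only [Function.comp_def, id] at this
    rw [← this]
    refine integral_mono (hξ i).integrable_sq (hBiL i).integrable_sq fun ω => ?_
    exact sq_le_sq.2 (hgB _ _)
  · rw [← (hW.exchangeable n).integral_sq_eq_secondMoment (S.measurable_WI n) i]
    exact integral_nonneg fun ω => sq_nonneg _

end Scheme

theorem tendstoInMeasure_zero_of_abs_le_add {Ω : Type*} [MeasurableSpace Ω] {P : Measure Ω}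
    {f g h : ℕ → Ω → ℝ} (hf : TendstoInMeasure P f atTop fun _ => 0)
    (hg : TendstoInMeasure P g atTop fun _ => 0)
    (hle : ∀ᶠ n in atTop, ∀ ω, |h n ω| ≤ |f n ω| + |g n ω|) :
    TendstoInMeasure P h atTop fun _ => 0 := by
  simp only [tendstoInMeasure_iff_norm, sub_zero, Real.norm_eq_abs] at *
  intro δ hδ
  refine tendsto_of_tendsto_of_tendsto_of_le_of_le' tendsto_const_nhds
    (by simpa using (hf (δ / 2) (by positivity)).add (hg (δ / 2) (by positivity)))
    (.of_forall fun _ => zero_le) ?_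
  filter_upwards [hle] with n hn
  refine (measure_mono fun ω (hω : δ ≤ |h n ω|) => ?_).trans (measure_union_le _ _)
  by_contra hcon
  simp only [Set.mem_union, Set.mem_ofPred_eq, not_or, not_le] at hcon
  linarith [hn ω]

/-! ### Joint measurability of membership in a cell -/

section Measurability

variable {d : ℕ}

theorem measurableSet_prod_side (j : Fin d) :
    MeasurableSet {t : ((Fin d → ℝ) × (Fin d → ℝ)) × (Fin d → ℝ) |
      t.2 j ∈ Set.Ioc (t.1.1 j) (t.1.2 j)} := by
  have h1 : MeasurableSet {t : ((Fin d → ℝ) × (Fin d → ℝ)) × (Fin d → ℝ) | t.1.1 j < t.2 j} :=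
    measurableSet_lt (by fun_prop) (by fun_prop)
  have h2 : MeasurableSet {t : ((Fin d → ℝ) × (Fin d → ℝ)) × (Fin d → ℝ) | t.2 j ≤ t.1.2 j} :=
    measurableSet_le (by fun_prop) (by fun_prop)
  exact h1.inter h2

theorem measurableSet_prod_cell :
    MeasurableSet {t : ((Fin d → ℝ) × (Fin d → ℝ)) × (Fin d → ℝ) |
      ∀ j, t.2 j ∈ Set.Ioc (t.1.1 j) (t.1.2 j)} := by
  simp only [Set.ofPred_forall]
  exact MeasurableSet.iInter measurableSet_prod_side

end Measurability

/-! ### Shrinking sides and vanishing residuals -/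

namespace Scheme

variable {Ω : Type*} [MeasurableSpace Ω] {Θ : Type*} [MeasurableSpace Θ] {d : ℕ}
  (S : Scheme Ω Θ d) {P : Measure Ω}

theorem leaf_bounds (n : ℕ) {x : Fin d → ℝ} (hx : x ∈ unitCube d) (ω : Ω) (j : Fin d) :
    0 ≤ (S.leaf n x ω).lower j ∧ (S.leaf n x ω).lower j ≤ x j ∧
      x j ≤ (S.leaf n x ω).upper j ∧ (S.leaf n x ω).upper j ≤ 1 :=
  SplitTree.leafFrom_bounds _ (Cell.root d) (S.splitsWithin_grow n _)
    (fun i => ⟨hx.1 i, hx.2 i⟩) j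

theorem tendsto_nI (h : HonestSizes S) : Tendsto (fun n => (S.nI n : ℝ)) atTop atTop := by
  obtain ⟨c, hc, hle⟩ := h.nI_order.2.exists_pos
  refine tendsto_atTop_mono' atTop ?_ (tendsto_natCast_atTop_atTop.atTop_div_const hc)
  filter_upwards [hle.bound] with n hn
  rw [div_le_iff₀ hc, mul_comm]
  simpa using hn

/-- With `s` the effective size, the expression equals $c\,(\mathbb E[W_1^2]/\mathbb
E[W_1])\,s^{1-2\beta}$, a convergent factor times a negative power of a diverging one. -/
theorem effectiveSize_rpow_bound (heff : Tendsto (S.effectiveSize P) atTop atTop)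
    (hW : WeightAssumption P S.WI) {β : ℝ} (hβ : 1 / 2 < β) (c : ℝ) :
    Tendsto (fun n => S.nI n * (secondMoment P (S.WI n) * c) / (S.effectiveSize P n ^ β) ^ 2)
      atTop (𝓝 0) := by
  obtain ⟨l, hl⟩ := hW.second
  have h1 := (tendsto_rpow_neg_atTop (y := 2 * β - 1) (by linarith)).comp heff
  have h2 := (hl.mul h1).mul_const c
  rw [mul_zero, zero_mul] at h2
  refine h2.congr' ?_
  filter_upwards [heff.eventually_gt_atTop 0] with n hn
  have he : meanWeight P (S.WI n) ≠ 0 := fun h0 => by simp [effectiveSize, h0] at hn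
  have hpow : (S.effectiveSize P n ^ β) ^ 2
      = S.effectiveSize P n ^ (2 * β - 1) * S.effectiveSize P n := by
    rw [← Real.rpow_natCast, ← Real.rpow_mul hn.le]
    nth_rewrite 3 [← Real.rpow_one (S.effectiveSize P n)]
    rw [← Real.rpow_add hn]
    congr 1
    push_cast
    ring
  have hpos := Real.rpow_pos_of_pos hn (2 * β - 1)
  simp only [Function.comp_apply]
  rw [hpow, Real.rpow_neg hn.le]
  generalize S.effectiveSize P n ^ (2 * β - 1) = t at hpos
  rw [effectiveSize] at hn ⊢
  have hn0 : (S.nI n : ℝ) ≠ 0 := fun h0 => by simp [h0] at hn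
  field_simp

/-- The second moment of the deviation is $o(1)+(1-1/n_{\mathcal I})\,\mathbb E[W_1W_2]/\mathbb
E[W_1]^2-1$, so the mixed-moment condition is exactly what makes it vanish. -/
theorem tendstoInMeasure_total [IsProbabilityMeasure P] (hsizes : HonestSizes S)
    (hW : WeightAssumption P S.WI) (heff : Tendsto (S.effectiveSize P) atTop atTop) :
    TendstoInMeasure P (fun n ω => (∑ i, S.WI n i ω) / S.effectiveSize P n - 1) atTop
      fun _ => 0 := by
  obtain ⟨l, hl⟩ := hW.second
  refine tendstoInMeasure_zero_of_integral_sq_le (b := fun n =>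
    secondMoment P (S.WI n) / meanWeight P (S.WI n) / (S.nI n * meanWeight P (S.WI n))
      + (1 - 1 / (S.nI n : ℝ)) * (mixedMoment P (S.WI n) / meanWeight P (S.WI n) ^ 2) - 1) ?_ ?_
  · filter_upwards [heff.eventually_gt_atTop 0, hW.memLp] with n hn hL
    obtain ⟨h1, h2⟩ := (hW.exchangeable n).integral_sq_sum_div_sub_one (S.measurable_WI n) hL hn
    exact ⟨h1, h2.le⟩
  · have h1 : Tendsto (fun n => 1 / (S.nI n : ℝ)) atTop (𝓝 0) := by
      simp only [one_div]
      exact tendsto_inv_atTop_zero.comp (S.tendsto_nI hsizes)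
    have h2 := ((hl.div_atTop heff).add ((h1.const_sub 1).mul hW.mixed)).sub_const 1
    simp only [sub_zero, mul_one, zero_add, sub_self] at h2
    exact h2

/-- The sides of the leaf shrink to zero. -/
theorem tendstoInMeasure_side [IsProbabilityMeasure P] (hiid : IIDObservations P S)
    (hsizes : HonestSizes S) (hindep : IndependentWeights P S) (hW : WeightAssumption P S.WI)
    (heff : Tendsto (S.effectiveSize P) atTop atTop) {x : Fin d → ℝ} (hx : x ∈ unitCube d)
    {f : (Fin d → ℝ) → ℝ} {ε : ℝ} (hε : 0 < ε) (hf : ∀ z ∈ unitCube d, ε ≤ f z)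
    (hlaw : P.map (S.X 0) = (volume.restrict (unitCube d)).withDensity
      fun z => ENNReal.ofReal (f z)) (j : Fin d)
    (hbalance : TendstoInMeasure P
      (fun n ω => S.sideCount n j x ω / S.effectiveSize P n) atTop fun _ => 0) :
    TendstoInMeasure P (fun n ω => ε * ((S.leaf n x ω).upper j - (S.leaf n x ω).lower j)) atTop
      fun _ => 0 := by
  have hX := S.measurable_X 0
  have := Measure.isProbabilityMeasure_map (μ := P) hX.aemeasurable
  let s : Set (((Fin d → ℝ) × (Fin d → ℝ)) × (Fin d → ℝ)) :=
    {t | t.2 j ∈ Set.Ioc (t.1.1 j) (t.1.2 j)}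
  have hs : MeasurableSet s := measurableSet_prod_side j
  -- The mass of the slab for frozen corners; subtracting it from the indicator gives a functional
  -- centred for each fixed leaf.
  let p : (Fin d → ℝ) × (Fin d → ℝ) → ℝ := fun u =>
    (P.map (S.X 0)).real {z | z j ∈ Set.Ioc (u.1 j) (u.2 j)}
  have hp : Measurable p := (measurable_measure_prodMk_left hs).ennreal_toReal
  have hp0 : ∀ u, 0 ≤ p u := fun u => measureReal_nonneg
  have hp1 : ∀ u, p u ≤ 1 := fun u => measureReal_le_one
  let g : ((Fin d → ℝ) × (Fin d → ℝ)) × ((Fin d → ℝ) × ℝ) → ℝ := fun t =>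
    s.indicator (fun _ => 1) (t.1, t.2.1) - p t.1
  have hg : Measurable g :=
    ((measurable_const.indicator hs).comp (by fun_prop)).sub (hp.comp measurable_fst)
  have hsu : ∀ u : (Fin d → ℝ) × (Fin d → ℝ),
      MeasurableSet {z : Fin d → ℝ | z j ∈ Set.Ioc (u.1 j) (u.2 j)} := fun u =>
    measurable_prodMk_left (x := u) hs
  have h0 : ∀ u, ∫ ω, g (u, S.X 0 ω, S.Y 0 ω) ∂P = 0 := fun u => by
    have hpre := hX (hsu u)
    have hind : ∀ ω, s.indicator (fun _ => (1 : ℝ)) (u, S.X 0 ω) =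
        (S.X 0 ⁻¹' {z | z j ∈ Set.Ioc (u.1 j) (u.2 j)}).indicator (fun _ => 1) ω := fun ω => rfl
    simp only [g, hind]
    rw [integral_sub ((integrable_const (1 : ℝ)).indicator hpre) (integrable_const _),
      integral_indicator_const 1 hpre]
    simp only [p]
    rw [map_measureReal_apply hX (hsu u)]
    simp
  have hg1 : ∀ u z, |g (u, z)| ≤ |(fun _ => 1 : (Fin d → ℝ) × ℝ → ℝ) z| := fun u z => by
    have hi : s.indicator (fun _ => (1 : ℝ)) (u, z.1) = 0 ∨
        s.indicator (fun _ => (1 : ℝ)) (u, z.1) = 1 := by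
      by_cases h : (u, z.1) ∈ s <;> simp [h]
    rw [abs_one, abs_le]
    dsimp only [g]
    rcases hi with hi | hi <;> rw [hi] <;> constructor <;> linarith [hp0 u, hp1 u]
  let V : ℕ → Ω → ℝ := fun n ω => ∑ i, S.WI n i ω * g (S.corners n x ω, S.obs n i ω)
  -- Envelope `1` and exponent `1`; the power is kept so that the rate lemma applies verbatim.
  have hV : TendstoInMeasure P (fun n ω => V n ω / S.effectiveSize P n ^ (1 : ℝ)) atTop
      fun _ => 0 := by
    refine tendstoInMeasure_zero_of_integral_sq_le ?_
      (S.effectiveSize_rpow_bound heff hW (β := 1) (by norm_num)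
        (∫ _, ((fun _ => 1 : (Fin d → ℝ) × ℝ → ℝ) 0) ^ 2 ∂P))
    filter_upwards [hW.memLp] with n hL
    obtain ⟨h1, h2⟩ := S.integral_sq_sum_le hiid hindep hW hL x hg h0 measurable_const
      (memLp_const _) hg1
    simp only [div_pow]
    refine ⟨h1.div_const _, ?_⟩
    rw [integral_div]
    gcongr
  have hR : TendstoInMeasure P
      (fun n ω => V n ω / S.effectiveSize P n ^ (1 : ℝ) - S.sideCount n j x ω / S.effectiveSize P n)
      atTop fun _ => 0 :=
    tendstoInMeasure_zero_of_abs_le_add hV hbalance (.of_forall fun n ω => abs_sub _ _)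
  refine tendstoInMeasure_zero_of_abs_le_add hR (S.tendstoInMeasure_total hsizes hW heff) ?_
  filter_upwards [heff.eventually_gt_atTop 0] with n hn ω
  obtain ⟨hb1, hb2, hb3, hb4⟩ := S.leaf_bounds n hx ω j
  have hslab : ε * ((S.leaf n x ω).upper j - (S.leaf n x ω).lower j) ≤ p (S.corners n x ω) :=
    mul_sub_le_measureReal_slab hε hf hlaw j hb1 hb4
  rw [abs_of_nonneg (mul_nonneg hε.le (by linarith))]
  refine hslab.trans ?_
  set P0 := p (S.corners n x ω) with hP0
  have hdec : V n ω = S.sideCount n j x ω - (∑ i, S.WI n i ω) * P0 := by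
    simp only [V, g, mul_sub, Finset.sum_sub_distrib, Finset.sum_mul]
    rfl
  -- The combination inside the first bracket is minus the normalized total weight times `P0`.
  -- Writing that weight as one plus its deviation isolates `P0`.
  have hid : P0 = -(V n ω / S.effectiveSize P n ^ (1 : ℝ)
      - S.sideCount n j x ω / S.effectiveSize P n)
      - ((∑ i, S.WI n i ω) / S.effectiveSize P n - 1) * P0 := by
    rw [hdec, Real.rpow_one]
    field_simp
    ring
  have hle : |((∑ i, S.WI n i ω) / S.effectiveSize P n - 1) * P0|
      ≤ |(∑ i, S.WI n i ω) / S.effectiveSize P n - 1| := by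
    rw [abs_mul, abs_of_nonneg (hp0 _ : 0 ≤ P0)]
    exact mul_le_of_le_one_right (abs_nonneg _) (hp1 _)
  have h3 := neg_abs_le (((∑ i, S.WI n i ω) / S.effectiveSize P n - 1) * P0)
  have h4 := neg_abs_le (V n ω / S.effectiveSize P n ^ (1 : ℝ)
      - S.sideCount n j x ω / S.effectiveSize P n)
  linarith

/-- The sum of the weighted residuals of the leaf is of smaller order than the leaf size. -/
theorem tendstoInMeasure_residual [IsProbabilityMeasure P] (hiid : IIDObservations P S)
    (hindep : IndependentWeights P S) (hW : WeightAssumption P S.WI)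
    (heff : Tendsto (S.effectiveSize P) atTop atTop) (hY : MemLp (S.Y 0) 2 P) (x : Fin d → ℝ)
    {μ : (Fin d → ℝ) → ℝ} (hμ : IsRegressionFunction P (S.X 0) (S.Y 0) μ) {β : ℝ}
    (hβ : 1 / 2 < β) :
    TendstoInMeasure P (fun n ω => (∑ i, S.WI n i ω * ((S.leaf n x ω).toSet.indicator 1
      (S.XI n ω i) * (S.YI n ω i - μ (S.XI n ω i)))) / S.effectiveSize P n ^ β) atTop
      fun _ => 0 := by
  have hX := S.measurable_X 0
  have hμm := hμ.measurable
  let s : Set (((Fin d → ℝ) × (Fin d → ℝ)) × (Fin d → ℝ)) :=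
    {t | ∀ j, t.2 j ∈ Set.Ioc (t.1.1 j) (t.1.2 j)}
  have hs : MeasurableSet s := measurableSet_prod_cell
  let B : (Fin d → ℝ) × ℝ → ℝ := fun z => z.2 - μ z.1
  have hB : Measurable B := by fun_prop
  let g : ((Fin d → ℝ) × (Fin d → ℝ)) × ((Fin d → ℝ) × ℝ) → ℝ := fun t =>
    s.indicator (fun _ => 1) (t.1, t.2.1) * B t.2
  have hg : Measurable g :=
    ((measurable_const.indicator hs).comp (by fun_prop)).mul (hB.comp measurable_snd)
  have hle : MeasurableSpace.comap (S.X 0) inferInstance ≤ ‹MeasurableSpace Ω› := hX.comap_le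
  have hμL : MemLp (fun ω => μ (S.X 0 ω)) 2 P :=
    (memLp_congr_ae hμ.condExp_eq).1 (hY.condExp (by norm_num))
  have hYi : Integrable (S.Y 0) P := hY.integrable (by norm_num)
  have hμi : Integrable (fun ω => μ (S.X 0 ω)) P := hμL.integrable (by norm_num)
  -- For fixed corners the event that `X` lies in the cell is `X`-measurable, so `Y` and its
  -- conditional expectation have the same integral over it.
  have h0 : ∀ u, ∫ ω, g (u, S.X 0 ω, S.Y 0 ω) ∂P = 0 := fun u => by
    have hsu : MeasurableSet {z : Fin d → ℝ | (u, z) ∈ s} := measurable_prodMk_left (x := u) hs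
    have hind : ∀ ω, g (u, S.X 0 ω, S.Y 0 ω) = (S.X 0 ⁻¹' {z | (u, z) ∈ s}).indicator
        (fun ω => S.Y 0 ω - μ (S.X 0 ω)) ω := fun ω => by
      by_cases h : (u, S.X 0 ω) ∈ s <;> simp [g, B, h]
    simp only [hind]
    rw [integral_indicator (hX hsu), integral_sub hYi.integrableOn hμi.integrableOn,
      ← setIntegral_condExp hle hYi ⟨_, hsu, rfl⟩,
      setIntegral_congr_ae (hX hsu) (hμ.condExp_eq.mono fun ω h _ => h), sub_self]
  have hgB : ∀ u z, |g (u, z)| ≤ |B z| := fun u z => by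
    by_cases h : (u, z.1) ∈ s <;> simp [g, h]
  refine tendstoInMeasure_zero_of_integral_sq_le ?_ (S.effectiveSize_rpow_bound heff hW hβ
    (∫ ω, B (S.X 0 ω, S.Y 0 ω) ^ 2 ∂P))
  filter_upwards [hW.memLp] with n hL
  obtain ⟨h1, h2⟩ := S.integral_sq_sum_le hiid hindep hW hL x hg h0 hB (hY.sub hμL) hgB
  simp only [div_pow]
  refine ⟨h1.div_const _, ?_⟩
  rw [integral_div]
  gcongr
  exact h2

theorem measurable_leafCount (n : ℕ) (x : Fin d → ℝ) : Measurable (S.leafCount n x) := by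
  have h : ∀ i, Measurable fun ω => S.WI n i ω * {t : ((Fin d → ℝ) × (Fin d → ℝ)) × (Fin d → ℝ) |
      ∀ j, t.2 j ∈ Set.Ioc (t.1.1 j) (t.1.2 j)}.indicator (fun _ => (1 : ℝ))
        (S.corners n x ω, (S.obs n i ω).1) := fun i =>
    (S.measurable_WI n i).mul ((measurable_const.indicator measurableSet_prod_cell).comp
      ((S.measurable_corners n x).prodMk (S.measurable_obs n i).fst))
  have hsum := Finset.measurable_fun_sum Finset.univ fun i _ => h i
  exact hsum

/-- Continuity of `μ` at `x` is only relative to the cube, so it can be used at an observation only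
once that observation is known to lie there. -/
theorem ae_obs_mem_unitCube (hiid : IIDObservations P S) {f : (Fin d → ℝ) → ℝ}
    (hlaw : P.map (S.X 0) = (volume.restrict (unitCube d)).withDensity
      fun z => ENNReal.ofReal (f z)) (n : ℕ) (i : Fin (S.nI n)) :
    ∀ᵐ ω ∂P, S.XI n ω i ∈ unitCube d := by
  have h0 : ∀ᵐ z ∂(P.map (S.X 0)), z ∈ unitCube d := by
    rw [hlaw]
    exact (withDensity_absolutelyContinuous _ _).ae_le (ae_restrict_mem measurableSet_Icc)
  have hid : IdentDistrib (fun ω => S.XI n ω i) (S.X 0) P P :=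
    (S.identDistrib_obs hiid n i).comp measurable_fst
  rw [← hid.map_eq] at h0
  exact ae_of_ae_map hid.aemeasurable_fst h0

end Scheme

end BootstrapTree

/-! ### Consistency -/

theorem mainTheorem10 {Ω : Type*} [MeasurableSpace Ω] (P : Measure Ω) [IsProbabilityMeasure P]
    {Θ : Type*} [MeasurableSpace Θ] {d : ℕ} (S : BootstrapTree.Scheme Ω Θ d)
    (hiid : BootstrapTree.IIDObservations P S)
    (hcov : BootstrapTree.CovariateAssumption P (S.X 0) (S.Y 0))
    (hsizes : BootstrapTree.HonestSizes S)
    (hindep : BootstrapTree.IndependentWeights P S)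
    (hW : BootstrapTree.WeightAssumption P S.WI)
    (heff : Tendsto (S.effectiveSize P) atTop atTop)
    (hmix : ∃ C : ℝ, ∀ᶠ n in atTop,
      BootstrapTree.adjustedMixedMoment P (S.WI n) ≤ C / (S.nI n : ℝ))
    (x : Fin d → ℝ) (hx : x ∈ BootstrapTree.unitCube d)
    (μ : (Fin d → ℝ) → ℝ) (hμ : BootstrapTree.IsRegressionFunction P (S.X 0) (S.Y 0) μ)
    (hμx : ContinuousWithinAt μ (BootstrapTree.unitCube d) x)
    (hbalance : ∀ j, TendstoInMeasure P
      (fun n ω => S.sideCount n j x ω / S.effectiveSize P n) atTop (fun _ => 0))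
    (β : ℝ) (hβ : β ∈ Set.Ioo (1 / 2 : ℝ) 1)
    (hleaf : Tendsto
      (fun n => P {ω | (⌈S.effectiveSize P n ^ β⌉ : ℝ) ≤ S.leafCount n x ω}) atTop (𝓝 1)) :
    TendstoInMeasure P (fun n ω => S.predictor n x ω) atTop (fun _ => μ x) := by
  obtain ⟨f, ε, C, hε, -, hf, hlaw⟩ := hcov.density
  have hside := fun j => S.tendstoInMeasure_side hiid hsizes hindep hW heff hx hε
    (fun z hz => (hf z hz).1) hlaw j (hbalance j)
  have hres := S.tendstoInMeasure_residual hiid hindep hW heff hcov.memLp_Y x hμ hβ.1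
  simp only [tendstoInMeasure_iff_norm, Real.norm_eq_abs, sub_zero] at hside hres ⊢
  intro δ hδ
  -- Error budget: bias at most `δ / 4`, variance term below `δ / 2`, hence a total strictly below
  -- `δ`.
  obtain ⟨η, hη, hμη⟩ := Metric.continuousWithinAt_iff.1 hμx (δ / 4) (by positivity)
  let V : ℕ → Ω → ℝ := fun n ω => ∑ i, S.WI n i ω * ((S.leaf n x ω).toSet.indicator 1
      (S.XI n ω i) * (S.YI n ω i - μ (S.XI n ω i)))
  let G : ℕ → Set Ω := fun n => {ω | (⌈S.effectiveSize P n ^ β⌉ : ℝ) ≤ S.leafCount n x ω}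
  have hG : Tendsto (fun n => P (G n)ᶜ) atTop (𝓝 0) := by
    have hGm : ∀ n, MeasurableSet (G n) := fun n =>
      measurableSet_le measurable_const (S.measurable_leafCount n x)
    simp_rw [prob_compl_eq_one_sub (hGm _)]
    simpa using ENNReal.Tendsto.sub (tendsto_const_nhds (x := (1 : ENNReal))) hleaf (by simp)
  have hη' : 0 < ε * (η / 2) := by positivity
  have hsum := tendsto_finsetSum Finset.univ fun j _ => hside j (ε * (η / 2)) hη'
  have hlim := (hG.add (hres (δ / 2) (by positivity))).add hsum
  simp only [Finset.sum_const_zero, add_zero] at hlim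
  refine tendsto_of_tendsto_of_tendsto_of_le_of_le' tendsto_const_nhds hlim
    (.of_forall fun _ => zero_le) ?_
  filter_upwards [heff.eventually_gt_atTop 0] with n hn
  have hpow := Real.rpow_pos_of_pos hn β
  -- An error of size `δ` forces, almost surely, one of three events of vanishing probability: a
  -- leaf with too little weight, a large residual sum, or a long side.
  refine le_trans ?_ (add_le_add ((measure_union_le (G n)ᶜ
    {ω | δ / 2 ≤ |V n ω / S.effectiveSize P n ^ β|})) (measure_iUnion_fintype_le P fun j =>
    {ω | ε * (η / 2) ≤ |ε * ((S.leaf n x ω).upper j - (S.leaf n x ω).lower j)|}))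
  refine le_trans (measure_mono_ae ?_) (measure_union_le _ _)
  filter_upwards [ae_all_iff.2 (hW.nonneg n), ae_all_iff.2 (S.ae_obs_mem_unitCube hiid hlaw n)]
    with ω hw hcube hbad
  by_contra hcon
  have hcon' : ω ∉ ((G n)ᶜ ∪ {ω | δ / 2 ≤ |V n ω / S.effectiveSize P n ^ β|}) ∪ ⋃ j,
    {ω | ε * (η / 2) ≤ |ε * ((S.leaf n x ω).upper j - (S.leaf n x ω).lower j)|} := hcon
  simp only [Set.mem_union, Set.mem_compl_iff, Set.mem_iUnion, not_or, not_not, not_exists,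
    Set.mem_ofPred_eq, not_le] at hcon'
  obtain ⟨⟨hcount, hV⟩, hsmall⟩ := hcon'
  have hN : S.effectiveSize P n ^ β ≤ S.leafCount n x ω := (Int.le_ceil _).trans hcount
  have hmain := BootstrapTree.abs_leafAverage_sub_le (y := S.YI n ω) (a := μ x) (r := δ / 4)
    (μ := μ) hw (hpow.trans_le hN) fun i hi => by
      -- In each coordinate, `x` and the observation lie between the same two corners, which are
      -- less than `η / 2` apart; hence their sup-distance is below `η`.
      refine (hμη (hcube i) ((dist_pi_lt_iff hη).2 fun j => ?_)).le
      obtain ⟨hb1, hb2, hb3, hb4⟩ := S.leaf_bounds n hx ω j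
      have hj := hsmall j
      rw [abs_of_nonneg (mul_nonneg hε.le (by linarith)), mul_lt_mul_iff_right₀ hε] at hj
      obtain ⟨h1, h2⟩ := hi j
      rw [Real.dist_eq, abs_lt]
      constructor <;> linarith
  have hVN : |V n ω| / S.leafCount n x ω ≤ |V n ω / S.effectiveSize P n ^ β| := by
    rw [abs_div, abs_of_pos hpow]
    gcongr
  have hbad' : δ ≤ |S.predictor n x ω - μ x| := hbad
  have hmain' : |S.predictor n x ω - μ x| ≤ |V n ω| / S.leafCount n x ω + δ / 4 := hmain
  linarith
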